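/- Let $N,M\in\mathbb N$, stoichiometric vectors $\nu_1,\dots,\nu_M\in\mathbb Z^N$ and propensities $a_j:\mathbb Z^N\to[0,\infty)$ be given, and put $a_0=\sum_j a_j$ and $\nu k=\sum_j k_j\nu_j$ for $k\in\mathbb Z_+^M$. Let $X$ be the associated chemical process: in state $y$ the waiting time to the next reaction is exponential with rate $a_0(y)$ (infinite if $a_0(y)=0$), and, independently of it, the next reaction is $j$ (a jump by $\nu_j$) with probability $a_j(y)/a_0(y)$. Assume that $X$ is non-explosive, and let $P(\tau,x,x')=\mathrm{Prob}(X(\tau)=x'\mid X(0)=x)$. Assume polynomial growth of the propensities: there are $s\in\mathbb Z_+$ and $\alpha>0$ with $a_j(x)\le\alpha(1+|x|^s)$ for all $j$ and all $x\in\mathbb Z^N$. Let $q\in\mathbb Z_+$, $\delta>0$, and let $S\subseteq\mathbb Z^N$ be a set of states (for instance $S=\mathbb Z^N$ or $S=\mathbb Z_+^N$). Consider a tau-leap method $Y(t+\tau)=x+\sum_{j}\nu_jK_j$ given $Y(t)=x$, and write $$\tilde\phi(\tau,x;k)=\mathrm{Prob}(K=k\mid Y(t)=x),\qquad \phi(\tau,x,x')=\mathrm{Prob}(x+\nu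 K=x'\mid Y(t)=x).$$ Suppose that for $x\in S$ and $\tau\in[0,\delta]$ the counts $K_1,\dots,K_M$ are independent given $Y(t)=x$, and that each $K_j$ is of one of the following two kinds: - $K_j$ is Poisson with parameter $\lambda_j(x,\tau)\ge 0$, where $\lambda_j$ is $q+1$ times continuously differentiable in $\tau\in[0,\delta]$, and $\sup_{\tau\in[0,\delta]}|\lambda_j^{(i)}(x,\tau)|$, $i=0,\dots,q+1$, are bounded on $S$ by a polynomial in $|x|$; - $K_j$ is binomial with parameters $N_j(x)\in\mathbb Z_+$ and $p_j(x,\tau)\in[0,1]$, where $p_j$ is $q+1$ times continuously differentiable in $\tau\in[0,\delta]$, and $N_j(x)$ and $\sup_{\tau\in[0,\delta]}|p_j^{(i)}(x,\tau)|$, $i=0,\dots,q+1$, are bounded on $S$ by a polynomial in $|x|$. For each $x$ let $\tilde Q(x;\cdot,\cdot)$ be the infinite matrix indexed by $\mathbb Z_+^M$ with $\tilde Q(x;k',k'+e_j)=a_j(x+\nu k')$, $\tilde Q(x;k',k')=-a_0(x+\nu k')$, and all other entries zero ($e_j$ is the $j$th unit vector). Suppose that the reaction counts are consistent of order $q$,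 that is, $$\tilde\phi^{(i)}(0,x;k)=\tilde Q^i(x;0,k)\qquad\text{for all }x\in S,\ k\in\mathbb Z_+^M,\ i=1,\dots,q.$$ Then the method is pointwise consistent of order $q$ on $S$: for all $x\in S$ and $x'\in\mathbb Z^N$ the function $\tau\mapsto\phi(\tau,x,x')$ is $q+1$ times continuously differentiable on $[0,\delta]$, the function $\tau\mapsto P(\tau,x,x')$ is infinitely differentiable on $[0,\infty)$, and $$\phi^{(i)}(0,x,x')=P^{(i)}(0,x,x'),\qquad i=1,\dots,q.$$ (Superscripts denote derivatives in $\tau$, one-sided at end points.) -/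

import Mathlib

open MeasureTheory ProbabilityTheory Set
open scoped ENNReal NNReal

noncomputable section

namespace TauLeap

/-- States: vectors of (integer) copy numbers of the `N` species. -/
abbrev State (N : ℕ) := Fin N → ℤ

/-- Reaction counts: vectors `k` of non-negative integers, one entry for each of the `M` channels. -/
abbrev Counts (M : ℕ) := Fin M → ℕ

variable {N M : ℕ}

/-- Total propensity `a₀(x) = ∑ⱼ aⱼ(x)`. -/
def totalPropensity (a : Fin M → State N → ℝ) (x : State N) : ℝ := ∑ j, a j x

/-- The state `x + ν k = x + ∑ⱼ kⱼ νⱼ` reached from `x` by the reaction counts `k`. -/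
def shift (ν : Fin M → State N) (x : State N) (k : Counts M) : State N := x + ∑ j, k j • ν j

/-! ### The exact chain -/

/-- The state reached from `x` after the first `n` reactions of the channel sequence `j`. -/
def chainState (ν : Fin M → State N) (x : State N) (j : ℕ → Fin M) (n : ℕ) : State N :=
  x + ∑ i ∈ Finset.range n, ν (j i)

/-- The chemical chain started at `x`, described by its successive waiting times `W 0, W 1, …`
(the value `∞` means that no further reaction occurs) and its successive reaction channels
`J 0, J 1, …`: whenever the chain is in the state `y`, the waiting time for the next reaction is
exponential with rate `a₀(y)` (and is `∞` if `a₀(y) = 0`), and, independently of it, the next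
reaction is `j` with probability `aⱼ(y) / a₀(y)`.  If `a₀(y) = 0`, every quotient `aⱼ(y) / a₀(y)`
is zero, so that the next waiting time is almost surely not finite. -/
structure IsChemicalChain {Ω : Type*} [MeasurableSpace Ω] (ν : Fin M → State N)
    (a : Fin M → State N → ℝ) (x : State N) (μ : Measure Ω)
    (W : ℕ → Ω → ℝ≥0∞) (J : ℕ → Ω → Fin M) : Prop where
  prob : IsProbabilityMeasure μ
  measurable_wait : ∀ n, Measurable (W n)
  measurable_channel : ∀ n, Measurable (J n)
  law : ∀ (n : ℕ) (j : ℕ → Fin M) (t : ℕ → ℝ), (∀ i, 0 ≤ t i) →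
    μ {ω | ∀ i < n, J i ω = j i ∧ ENNReal.ofReal (t i) ≤ W i ω ∧ W i ω < ∞} =
      ENNReal.ofReal (∏ i ∈ Finset.range n,
        (a (j i) (chainState ν x j i) / totalPropensity a (chainState ν x j i) *
          Real.exp (-(totalPropensity a (chainState ν x j i)) * t i)))

/-- The time of the `(n+1)`-st reaction. -/
def reactionTime {Ω : Type*} (W : ℕ → Ω → ℝ≥0∞) (n : ℕ) (ω : Ω) : ℝ≥0∞ :=
  ∑ i ∈ Finset.range (n + 1), W i ω

/-- Non-explosivity: almost surely, only finitely many reactions occur in each bounded time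
interval. -/
def NonExplosive {Ω : Type*} [MeasurableSpace Ω] (μ : Measure Ω) (W : ℕ → Ω → ℝ≥0∞) : Prop :=
  ∀ᵐ ω ∂μ, ∀ t : ℝ, {n | reactionTime W n ω ≤ ENNReal.ofReal t}.Finite

/-- `Rⱼ(t)`: the number of firings of channel `j` during `(0, t]`. -/
def reactionCount {Ω : Type*} (W : ℕ → Ω → ℝ≥0∞) (J : ℕ → Ω → Fin M) (t : ℝ) (ω : Ω) :
    Counts M :=
  fun j => {n | reactionTime W n ω ≤ ENNReal.ofReal t ∧ J n ω = j}.ncard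

/-- The transition probabilities `P(τ, x, x') = Prob(X(τ) = x' | X(0) = x)`, where
`X(t) = x + ν R(t)`; here `μ x` is the law of the chain started at `x`. -/
def transition {Ω : Type*} [MeasurableSpace Ω] (ν : Fin M → State N)
    (μ : State N → Measure Ω) (W : ℕ → Ω → ℝ≥0∞) (J : ℕ → Ω → Fin M)
    (τ : ℝ) (x x' : State N) : ℝ :=
  (μ x).real {ω | shift ν x (reactionCount W J τ ω) = x'}

/-! ### Tau leap methods -/

/-- `φ̃(τ, x; k) = Prob(K = k | Y(t) = x)`, where `κ τ x` is the conditional law of `K`, given that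
the current state is `x` and the step size is `τ`. -/
def countProb (κ : ℝ → State N → Measure (Counts M)) (τ : ℝ) (x : State N) (k : Counts M) : ℝ :=
  (κ τ x).real {k}

/-- `φ(τ, x, x')`: the conditional probability that `Y(t + τ) = x + ν K` equals `x'`, given that
`Y(t) = x`. -/
def leapProb (ν : Fin M → State N) (κ : ℝ → State N → Measure (Counts M))
    (τ : ℝ) (x x' : State N) : ℝ :=
  (κ τ x).real {k | shift ν x k = x'}

/-- On the states in `S` and the step sizes in `[0, δ]`, the law `κ` on `ℕ` is Poisson with a
parameter `lam x τ` that is `q + 1` times continuously differentiable in `τ`; the parameter and its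
derivatives up to order `q + 1` are bounded, uniformly in `τ`, by a polynomial in `|x|`. -/
def IsPoissonUpdate (q : ℕ) (δ : ℝ) (S : Set (State N)) (κ : ℝ → State N → Measure ℕ) : Prop :=
  ∃ lam : State N → ℝ → ℝ,
    (∀ x ∈ S, ∀ τ ∈ Icc 0 δ, 0 ≤ lam x τ ∧ κ τ x = poissonMeasure (lam x τ).toNNReal) ∧
    (∀ x ∈ S, ContDiffOn ℝ ((q + 1 : ℕ) : ℕ∞) (lam x) (Icc 0 δ)) ∧
    ∃ B : Polynomial ℝ, ∀ i ≤ q + 1, ∀ x ∈ S, ∀ τ ∈ Icc 0 δ,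
      |iteratedDerivWithin i (lam x) (Icc 0 δ) τ| ≤ B.eval ‖x‖

/-- On the states in `S` and the step sizes in `[0, δ]`, the law `κ` on `ℕ` is binomial with
parameters `N₀ x` and `p x τ`, where `p` is `q + 1` times continuously differentiable in `τ`;
`N₀`, as well as `p` and its derivatives up to order `q + 1`, uniformly in `τ`, are bounded by a
polynomial in `|x|`. -/
def IsBinomialUpdate (q : ℕ) (δ : ℝ) (S : Set (State N)) (κ : ℝ → State N → Measure ℕ) : Prop :=
  ∃ (N₀ : State N → ℕ) (p : State N → ℝ → ℝ),
    (∀ x ∈ S, ∀ τ ∈ Icc 0 δ, ∃ h : p x τ ∈ unitInterval,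
      κ τ x = ProbabilityTheory.binomial (N₀ x) ⟨p x τ, h⟩) ∧
    (∀ x ∈ S, ContDiffOn ℝ ((q + 1 : ℕ) : ℕ∞) (p x) (Icc 0 δ)) ∧
    ∃ B : Polynomial ℝ, (∀ x ∈ S, (N₀ x : ℝ) ≤ B.eval ‖x‖) ∧
      ∀ i ≤ q + 1, ∀ x ∈ S, ∀ τ ∈ Icc 0 δ,
        |iteratedDerivWithin i (p x) (Icc 0 δ) τ| ≤ B.eval ‖x‖

/-- Given the current state `x ∈ S` and `τ ∈ [0, δ]`, the counts `K₁, …, K_M` are independent, and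
each of them is Poisson or binomially distributed, with parameters as described above. -/
structure IsPoissonBinomialMethod (q : ℕ) (δ : ℝ) (S : Set (State N))
    (κ : ℝ → State N → Measure (Counts M)) : Prop where
  prob : ∀ x ∈ S, ∀ τ ∈ Icc 0 δ, IsProbabilityMeasure (κ τ x)
  indep : ∀ x ∈ S, ∀ τ ∈ Icc 0 δ, iIndepFun (fun (j : Fin M) (k : Counts M) => k j) (κ τ x)
  marginal : ∀ j : Fin M,
    IsPoissonUpdate q δ S (fun τ x => (κ τ x).map (fun k => k j)) ∨
    IsBinomialUpdate q δ S (fun τ x => (κ τ x).map (fun k => k j))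

/-! ### Assumptions and consistency -/

/-- All propensities have polynomial growth of some common degree `s`. -/
def PolynomialGrowth (a : Fin M → State N → ℝ) : Prop :=
  ∃ s : ℕ, ∀ j, ∃ α > 0, ∀ x, |a j x| ≤ α * (‖x‖ ^ s + 1)

/-- The infinite matrix `Q̃(x; k', k)`: it is `aⱼ(x + ν k')` if `k = k' + eⱼ`, it is
`-a₀(x + ν k')` if `k = k'`, and it is zero otherwise. -/
def countGenerator (ν : Fin M → State N) (a : Fin M → State N → ℝ) (x : State N)
    (k' k : Counts M) : ℝ :=
  (∑ j, if k = k' + Pi.single j 1 then a j (shift ν x k') else 0) -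
    if k = k' then totalPropensity a (shift ν x k') else 0

open Classical in
/-- The powers of an infinite matrix (used only for a matrix each of whose rows and columns has
finitely many non-zero entries, so that the sum is a finite one). -/
def matPow {ι : Type*} (A : ι → ι → ℝ) : ℕ → ι → ι → ℝ
  | 0 => fun k' k => if k' = k then 1 else 0
  | i + 1 => fun k' k => ∑ᶠ l, matPow A i k' l * A l k

/-- Consistency of order `q` of the reaction counts, at the states in `S`:
`φ̃^(i)(0, x; k) = Q̃^i(x; 0, k)` for all `k` and `i = 1, …, q`. -/
def CountConsistent (q : ℕ) (δ : ℝ) (S : Set (State N)) (ν : Fin M → State N)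
    (a : Fin M → State N → ℝ) (κ : ℝ → State N → Measure (Counts M)) : Prop :=
  ∀ x ∈ S, ∀ (k : Counts M) (i : ℕ), 1 ≤ i → i ≤ q →
    iteratedDerivWithin i (fun τ => countProb κ τ x k) (Icc 0 δ) 0 =
      matPow (countGenerator ν a x) i 0 k

/-- Pointwise consistency of order `q` of `φ` with `P`, at the states in `S`: `φ(τ, x, x')` is
`q + 1` times continuously differentiable in `τ ∈ [0, δ]`, `P(τ, x, x')` is smooth in
`τ ∈ [0, ∞)`, and `φ^(i)(0, x, x') = P^(i)(0, x, x')` for `i = 1, …, q` (one-sided derivatives). -/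
def PointwiseConsistent (q : ℕ) (δ : ℝ) (S : Set (State N))
    (φ P : ℝ → State N → State N → ℝ) : Prop :=
  ∀ x ∈ S, ∀ x' : State N,
    ContDiffOn ℝ ((q + 1 : ℕ) : ℕ∞) (fun τ => φ τ x x') (Icc 0 δ) ∧
    ContDiffOn ℝ (⊤ : ℕ∞) (fun τ => P τ x x') (Ici 0) ∧
    ∀ i : ℕ, 1 ≤ i → i ≤ q →
      iteratedDerivWithin i (fun τ => φ τ x x') (Icc 0 δ) 0 =
        iteratedDerivWithin i (fun τ => P τ x x') (Ici 0) 0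

end TauLeap

end

/-! Both derivatives at `0` turn out to be the same power of the generator. With `(G f)(y) = ∑ j, a
j y * f (y + ν j) - a₀(y) * f y` and `f` the indicator of `x'`, each side equals `(G^i f)(x)`.

Leap side. A count probability that is smooth for each `k` does not suffice, since infinitely many
`k` may lead to the same `x'`. The law of `K` is therefore treated as a curve in `ℓ¹(Counts M)`.
Adding an independent count in direction `j` is an operator in the right shift `R_j`: `exp(-λ) exp(λ
R_j)` in the Poisson case, a polynomial in `R_j` in the binomial case. Both are as smooth in `τ` as
their parameters, so the joint law, obtained by applying them successively to the point mass at `0`,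
is too. Summation over the fibre of `x'` is a continuous functional on `ℓ¹`, so differentiation is
termwise (`IsPoissonBinomialMethod.leapProb_deriv`). Consistency replaces each term by an entry of a
power of the count generator, and summing over fibres turns that matrix into `G`
(`tsum_indicator_matPow`).

Exact side. Non-explosion writes `P` as a sum over finite reaction histories
(`IsChemicalChain.measure_transition`). Splitting off the first reaction gives the integrated
backward equation. Its solution is bounded by `1`, hence continuous, hence differentiable. Since `G`
is a finite sum at each state, `P' = G P` iterates to all orders (`transition_deriv`). -/

namespace TauLeap

/-! ### Smooth curves in `ℓ¹` -/

section LOne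

/-- The summable real functions on `ι`. -/
abbrev LOne (ι : Type*) := lp (fun _ : ι => ℝ) 1

lemma summable_lOne {ι : Type*} (f : LOne ι) : Summable fun k => f k := by
  have := (lp.memℓp f).summable (by simp)
  exact Summable.of_norm (by simpa using this)

lemma norm_lOne {ι : Type*} (f : LOne ι) : ‖f‖ = ∑' k, ‖f k‖ := by
  rw [lp.norm_eq_tsum_rpow (by simp)]
  simp only [ENNReal.toReal_one, Real.rpow_one, div_one]

lemma memLOne {ι : Type*} {f : ι → ℝ} (hf : Summable f) : Memℓp f 1 :=
  memℓp_gen (by simpa using hf.norm)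

/-- Summation of an `ℓ¹` function over a set, as a continuous linear map. -/
noncomputable def sumOn {ι : Type*} (A : Set ι) : LOne ι →L[ℝ] ℝ :=
  LinearMap.mkContinuous
    { toFun f := ∑' k, A.indicator f k
      map_add' f g := by
        rw [← ((summable_lOne f).indicator A).tsum_add ((summable_lOne g).indicator A)]
        exact tsum_congr fun k => congrFun (indicator_add A (f : ι → ℝ) g) k
      map_smul' c f := by
        rw [RingHom.id_apply, smul_eq_mul, ← tsum_mul_left]
        refine tsum_congr fun k => ?_
        by_cases h : k ∈ A <;> simp [h] }
    1 (fun f => by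
      rw [one_mul, norm_lOne]
      have h1 : Summable fun k => ‖A.indicator f k‖ := ((summable_lOne f).indicator A).norm
      exact (norm_tsum_le_tsum_norm h1).trans
        (h1.tsum_le_tsum (fun k => norm_indicator_le_norm_self _ _) (summable_lOne f).norm))

lemma sumOn_apply {ι : Type*} (A : Set ι) (f : LOne ι) : sumOn A f = ∑' k, A.indicator f k := rfl

variable {M : ℕ}

lemma update_succ_injective (j : Fin M) :
    Function.Injective fun k : Counts M => Function.update k j (k j + 1) := by
  intro k l h
  funext i
  have := congrFun h i
  by_cases hi : i = j
  · subst hi; simpa using this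
  · simpa [hi] using this

/-- The right shift in the direction `j`: it maps `f` to `k ↦ f (k - eⱼ)`. -/
noncomputable def rightShift (j : Fin M) : LOne (Counts M) →L[ℝ] LOne (Counts M) :=
  LinearMap.mkContinuous
    { toFun f := ⟨Function.extend (fun k : Counts M => Function.update k j (k j + 1)) f 0,
        memLOne ((summable_extend_zero (update_succ_injective j)).2 (summable_lOne f))⟩
      map_add' f g := by
        refine lp.ext ?_
        have := Function.extend_add (fun k : Counts M => Function.update k j (k j + 1))
          (f : Counts M → ℝ) g 0 0
        rw [add_zero] at this
        exact this
      map_smul' c f := by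
        refine lp.ext ?_
        have := Function.extend_smul c (fun k : Counts M => Function.update k j (k j + 1))
          (f : Counts M → ℝ) 0
        rw [smul_zero] at this
        exact this }
    1 (fun f => by
      -- Extension by zero along an injection preserves the `ℓ¹` norm, so the constant `1` is
      -- attained.
      rw [one_mul, norm_lOne, norm_lOne, 
        ← tsum_extend_zero (update_succ_injective j) (fun k => ‖f k‖)]
      refine le_of_eq (tsum_congr fun k => ?_)
      change ‖Function.extend (fun k : Counts M => Function.update k j (k j + 1)) f 0 k‖ = _
      by_cases h : ∃ l : Counts M, Function.update l j (l j + 1) = k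
      · obtain ⟨l, rfl⟩ := h
        exact (congrArg norm ((update_succ_injective j).extend_apply _ _ l)).trans
          ((update_succ_injective j).extend_apply (fun k => ‖f k‖) 0 l).symm
      · rw [Function.extend_apply' _ _ _ h, Function.extend_apply' _ _ _ h]
        simp)

lemma rightShift_apply (j : Fin M) (f : LOne (Counts M)) (k : Counts M) :
    rightShift j f k = if 1 ≤ k j then f (Function.update k j (k j - 1)) else 0 := by
  change Function.extend (fun k : Counts M => Function.update k j (k j + 1)) f 0 k = _
  split_ifs with h
  · have : k = (fun k : Counts M => Function.update k j (k j + 1))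
        (Function.update k j (k j - 1)) := by
      simp [Nat.sub_add_cancel h]
    conv_lhs => rw [this]
    rw [(update_succ_injective j).extend_apply]
  · rw [Function.extend_apply', Pi.zero_apply]
    rintro ⟨l, rfl⟩
    simp at h

lemma rightShift_pow_apply (j : Fin M) (m : ℕ) (f : LOne (Counts M)) (k : Counts M) :
    (rightShift j ^ m) f k = if m ≤ k j then f (Function.update k j (k j - m)) else 0 := by
  induction m generalizing k with
  | zero => simp
  | succ m ih =>
    rw [pow_succ', mul_apply_eq_comp, rightShift_apply, ih]
    by_cases h : m + 1 ≤ k j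
    · have h1 : 1 ≤ k j := by omega
      have h2 : m ≤ k j - 1 := by omega
      simp [h, h1, h2, Nat.sub_sub, add_comm]
    · by_cases h1 : 1 ≤ k j
      · have h2 : ¬ m ≤ k j - 1 := by omega
        simp [h, h1, h2]
      · simp [h, h1]

/-- `U` is a curve of operators on `ℓ¹`, namely the convolutions with the distributions `p τ` in
the direction `j`. -/
def IsConvolution (j : Fin M) (p : ℝ → ℕ → ℝ) (s : Set ℝ)
    (U : ℝ → LOne (Counts M) →L[ℝ] LOne (Counts M)) : Prop :=
  ∀ τ ∈ s, ∀ f k, U τ f k =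
    ∑ m ∈ Finset.range (k j + 1), p τ m * f (Function.update k j (k j - m))

/-- The operator is `exp(-λ) exp(λ R)` with `R` the right shift, and `exp` is analytic on the Banach
algebra of bounded operators. Evaluated at `k`, the exponential series is finite because `R ^ m f`
vanishes there once `m > k j`. -/
lemma exists_isConvolution_poisson (j : Fin M) {n : ℕ∞} {s : Set ℝ} {lam : ℝ → ℝ}
    (hlam : ContDiffOn ℝ n lam s) :
    ∃ U, ContDiffOn ℝ n U s ∧
      IsConvolution j (fun τ m => Real.exp (-lam τ) * lam τ ^ m / m.factorial) s U := by
  have hexp : ContDiff ℝ n (fun T : LOne (Counts M) →L[ℝ] LOne (Counts M) =>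
      NormedSpace.exp T) := by
    refine contDiff_iff_contDiffAt.2 fun T => ?_
    exact (NormedSpace.exp_analytic (𝕂 := ℝ) T).contDiffAt
  refine ⟨fun τ => Real.exp (-lam τ) • NormedSpace.exp (lam τ • rightShift j), ?_, ?_⟩
  · exact (Real.contDiff_exp.comp_contDiffOn hlam.neg).smul
      (hexp.comp_contDiffOn (hlam.smul contDiffOn_const))
  · intro τ _ f k
    have h := NormedSpace.exp_series_hasSum_exp' (𝕂 := ℝ) (lam τ • rightShift j)
    have h2 := h.mapL ((lp.evalCLM ℝ (fun _ : Counts M => ℝ) 1 k).comp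
      (ContinuousLinearMap.apply ℝ (LOne (Counts M)) f))
    have h3 : ∀ m : ℕ, ((lp.evalCLM ℝ (fun _ : Counts M => ℝ) 1 k).comp
      (ContinuousLinearMap.apply ℝ (LOne (Counts M)) f))
        (((m.factorial : ℝ)⁻¹) • (lam τ • rightShift j) ^ m) =
        if m ≤ k j then lam τ ^ m / m.factorial * f (Function.update k j (k j - m)) else 0 := by
      intro m
      have : ((m.factorial : ℝ)⁻¹ * (lam τ ^ m * ((rightShift j ^ m) f k))) =
        if m ≤ k j then lam τ ^ m / m.factorial * f (Function.update k j (k j - m)) else 0 := by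
        rw [rightShift_pow_apply]
        split_ifs
        · ring
        · ring
      rw [← this, smul_pow]
      rfl
    simp only [h3] at h2
    have h4 := hasSum_sum_of_ne_finset_zero (L := .unconditional ℕ) (f := fun m => if m ≤ k j then
      lam τ ^ m / m.factorial * f (Function.update k j (k j - m)) else 0)
      (s := Finset.range (k j + 1)) (fun m hm => by
        rw [if_neg]; simpa [Nat.lt_succ_iff] using hm)
    have h5 := h2.unique h4
    change Real.exp (-lam τ) * (NormedSpace.exp (lam τ • rightShift j) f k) = _
    have h6 : (NormedSpace.exp (lam τ • rightShift j) f k) = _ := h5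
    rw [h6, Finset.mul_sum]
    refine Finset.sum_congr rfl fun m hm => ?_
    rw [if_pos (by simpa [Nat.lt_succ_iff] using hm)]
    ring

lemma exists_isConvolution_binomial (j : Fin M) {n : ℕ∞} {s : Set ℝ} (N : ℕ) {p : ℝ → ℝ}
    (hp : ContDiffOn ℝ n p s) :
    ∃ U, ContDiffOn ℝ n U s ∧
      IsConvolution j (fun τ m => N.choose m * p τ ^ m * (1 - p τ) ^ (N - m)) s U := by
  refine ⟨fun τ => ∑ m ∈ Finset.range (N + 1),
    (N.choose m * p τ ^ m * (1 - p τ) ^ (N - m)) • rightShift j ^ m, ?_, ?_⟩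
  · refine ContDiffOn.sum fun m _ => ContDiffOn.fun_smul ?_ contDiffOn_const
    exact (contDiffOn_const.mul (hp.pow m)).mul ((contDiffOn_const.sub hp).pow _)
  · intro τ _ f k
    have h1 : (∑ m ∈ Finset.range (N + 1),
        (N.choose m * p τ ^ m * (1 - p τ) ^ (N - m)) • rightShift j ^ m) f k =
        ∑ m ∈ Finset.range (N + 1), (N.choose m * p τ ^ m * (1 - p τ) ^ (N - m)) *
          (if m ≤ k j then f (Function.update k j (k j - m)) else 0) := by
      have := map_sum ((lp.evalCLM ℝ (fun _ : Counts M => ℝ) 1 k).comp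
        (ContinuousLinearMap.apply ℝ (LOne (Counts M)) f))
        (fun m => (N.choose m * p τ ^ m * (1 - p τ) ^ (N - m)) • rightShift j ^ m)
        (Finset.range (N + 1))
      refine this.trans (Finset.sum_congr rfl fun m _ => ?_)
      rw [← rightShift_pow_apply]
      rfl
    rw [h1]
    have h2 : ∀ n : ℕ, ∀ m ∉ Finset.range (n + 1), n < m := fun n m hm => by simpa using hm
    -- Both sums are extended to the range up to `max N (k j)`: the binomial coefficient kills `m >
    -- N`, the shift kills `m > k j`.
    have h3 := Finset.sum_subset (Finset.range_mono (show N + 1 ≤ max N (k j) + 1 by omega))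
      (f := fun m => (N.choose m * p τ ^ m * (1 - p τ) ^ (N - m)) *
        (if m ≤ k j then f (Function.update k j (k j - m)) else 0))
      (fun m _ hm => by simp [Nat.choose_eq_zero_of_lt (h2 _ m hm)])
    have h4 := Finset.sum_subset (Finset.range_mono (show k j + 1 ≤ max N (k j) + 1 by omega))
      (f := fun m => (N.choose m * p τ ^ m * (1 - p τ) ^ (N - m)) *
        (if m ≤ k j then f (Function.update k j (k j - m)) else 0))
      (fun m _ hm => by simp [h2 _ m hm])
    rw [h3, ← h4]
    refine Finset.sum_congr rfl fun m hm => ?_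
    rw [if_pos (by simpa [Nat.lt_succ_iff] using hm)]

/-- A product distribution whose factors act smoothly by convolution is a smooth curve in `ℓ¹`. -/
lemma exists_contDiffOn_lOne_prod {n : ℕ∞} {s : Set ℝ} (p : Fin M → ℝ → ℕ → ℝ)
    (hp : ∀ j, ∃ U, ContDiffOn ℝ n U s ∧ IsConvolution j (p j) s U) :
    ∃ g : ℝ → LOne (Counts M), ContDiffOn ℝ n g s ∧
      ∀ τ ∈ s, ∀ k, g τ k = ∏ j, p j τ (k j) := by
  classical
  choose U hU hconv using hp
  -- Induction on the set of channels already drawn; the remaining coordinates are still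
  -- concentrated at `0`.
  have key : ∀ t : Finset (Fin M), ∃ g : ℝ → LOne (Counts M), ContDiffOn ℝ n g s ∧
      ∀ τ ∈ s, ∀ k, g τ k = ∏ j, if j ∈ t then p j τ (k j) else if k j = 0 then 1 else 0 := by
    intro t
    induction t using Finset.induction_on with
    | empty =>
      refine ⟨fun _ => lp.single 1 0 1, contDiffOn_const, fun τ _ k => ?_⟩
      by_cases hk : k = 0
      · subst hk; simp
      · rw [lp.single_apply_ne _ _ _ hk]
        obtain ⟨j, hj⟩ := Function.ne_iff.1 hk
        exact (Finset.prod_eq_zero (Finset.mem_univ j) (by simpa using hj)).symm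
    | insert i t hi ih =>
      obtain ⟨g, hg, hgk⟩ := ih
      refine ⟨fun τ => U i τ (g τ), (hU i).clm_apply hg, fun τ hτ k => ?_⟩
      -- Before channel `i` is drawn all mass sits at `i`-th coordinate `0`, so only `m = k i`
      -- contributes.
      rw [hconv i τ hτ, Finset.sum_eq_single (k i)]
      · rw [hgk τ hτ, ← Finset.mul_prod_erase _ _ (Finset.mem_univ i),
          ← Finset.mul_prod_erase (a := i) _ (fun j => if j ∈ insert i t then _ else _)
            (Finset.mem_univ i)]
        simp only [hi, Nat.sub_self, Function.update_self, if_true, if_false, one_mul,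
          Finset.mem_insert_self]
        congr 1
        refine Finset.prod_congr rfl fun j hj => ?_
        have hji : j ≠ i := Finset.ne_of_mem_erase hj
        simp [hji]
      · intro m hm hmk
        rw [hgk τ hτ, Finset.prod_eq_zero (Finset.mem_univ i), mul_zero]
        have : k i - m ≠ 0 := by
          have := Finset.mem_range.1 hm
          omega
        simp [hi, this]
      · intro h
        simp at h
  obtain ⟨g, hg, hgk⟩ := key Finset.univ
  exact ⟨g, hg, fun τ hτ k => by simp [hgk τ hτ k]⟩

end LOne

/-! ### The probabilities of the tau leap method -/

section Leap

variable {N M : ℕ} {q : ℕ} {δ : ℝ} {S : Set (State N)} {κ : ℝ → State N → Measure (Counts M)}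

lemma countProb_eq_prod (hκ : IsPoissonBinomialMethod q δ S κ) {x : State N} (hx : x ∈ S) {τ : ℝ}
    (hτ : τ ∈ Icc 0 δ) (k : Counts M) :
    countProb κ τ x k = ∏ j, ((κ τ x).map (fun k => k j)).real {k j} := by
  have h := (hκ.indep x hx τ hτ).measure_inter_preimage_eq_mul Finset.univ
    (sets := fun j => {k j}) (fun j _ => measurableSet_singleton _)
  have hset : (⋂ j ∈ (Finset.univ : Finset (Fin M)),
      (fun l : Counts M => l j) ⁻¹' {k j}) = {k} := by
    ext l
    simp [funext_iff]
  rw [hset] at h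
  rw [countProb, measureReal_def, h, ENNReal.toReal_prod]
  refine Finset.prod_congr rfl fun j _ => ?_
  rw [measureReal_def, Measure.map_apply (measurable_pi_apply j) (measurableSet_singleton _)]

lemma IsPoissonUpdate.exists_isConvolution {κ₀ : ℝ → State N → Measure ℕ}
    (h : IsPoissonUpdate q δ S κ₀) {x : State N} (hx : x ∈ S) (j : Fin M) :
    ∃ U, ContDiffOn ℝ ((q + 1 : ℕ) : ℕ∞) U (Icc 0 δ) ∧
      IsConvolution j (fun τ m => (κ₀ τ x).real {m}) (Icc 0 δ) U := by
  obtain ⟨lam, hlam, hsmooth, -⟩ := h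
  obtain ⟨U, hU, hc⟩ := exists_isConvolution_poisson j (hsmooth x hx)
  refine ⟨U, hU, fun τ hτ f k => ?_⟩
  rw [hc τ hτ]
  refine Finset.sum_congr rfl fun m _ => ?_
  dsimp only
  rw [(hlam x hx τ hτ).2, poissonMeasure_real_singleton, Real.coe_toNNReal _ (hlam x hx τ hτ).1]

lemma IsBinomialUpdate.exists_isConvolution {κ₀ : ℝ → State N → Measure ℕ}
    (h : IsBinomialUpdate q δ S κ₀) {x : State N} (hx : x ∈ S) (j : Fin M) :
    ∃ U, ContDiffOn ℝ ((q + 1 : ℕ) : ℕ∞) U (Icc 0 δ) ∧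
      IsConvolution j (fun τ m => (κ₀ τ x).real {m}) (Icc 0 δ) U := by
  obtain ⟨N₀, p, hp, hsmooth, -⟩ := h
  obtain ⟨U, hU, hc⟩ := exists_isConvolution_binomial j (N₀ x) (hsmooth x hx)
  refine ⟨U, hU, fun τ hτ f k => ?_⟩
  rw [hc τ hτ]
  refine Finset.sum_congr rfl fun m _ => ?_
  obtain ⟨hI, hκ⟩ := hp x hx τ hτ
  dsimp only
  rw [hκ, binomial_real_singleton]

lemma IsPoissonBinomialMethod.exists_contDiffOn_lOne (hκ : IsPoissonBinomialMethod q δ S κ)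
    {x : State N} (hx : x ∈ S) :
    ∃ g : ℝ → LOne (Counts M), ContDiffOn ℝ ((q + 1 : ℕ) : ℕ∞) g (Icc 0 δ) ∧
      ∀ τ ∈ Icc 0 δ, ∀ k, g τ k = countProb κ τ x k := by
  obtain ⟨g, hg, hgk⟩ := exists_contDiffOn_lOne_prod (n := ((q + 1 : ℕ) : ℕ∞)) (s := Icc 0 δ)
    (fun (j : Fin M) τ m => ((κ τ x).map (fun k => k j)).real {m}) (fun j => by
      rcases hκ.marginal j with h | h
      · exact h.exists_isConvolution hx j
      · exact h.exists_isConvolution hx j)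
  exact ⟨g, hg, fun τ hτ k => by rw [hgk τ hτ, countProb_eq_prod hκ hx hτ]⟩

lemma leapProb_eq_tsum (hκ : IsPoissonBinomialMethod q δ S κ) (ν : Fin M → State N)
    {x : State N} (hx : x ∈ S) {τ : ℝ} (hτ : τ ∈ Icc 0 δ) (x' : State N) :
    leapProb ν κ τ x x' = ∑' k, {k | shift ν x k = x'}.indicator (countProb κ τ x) k := by
  have := hκ.prob x hx τ hτ
  rw [leapProb, measureReal_def, ← Measure.tsum_indicator_apply_singleton _ _
    (Set.to_countable _).measurableSet, ENNReal.tsum_toReal_eq]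
  · refine tsum_congr fun k => ?_
    by_cases hk : k ∈ {k | shift ν x k = x'}
    · simp only [indicator_of_mem hk]; rfl
    · simp only [indicator_of_notMem hk, ENNReal.toReal_zero]
  · intro k
    by_cases hk : k ∈ {k | shift ν x k = x'}
    · simp only [indicator_of_mem hk]; exact measure_ne_top _ _
    · simp only [indicator_of_notMem hk]; exact ENNReal.zero_ne_top

lemma iteratedDerivWithin_clm_comp {E F : Type*} [NormedAddCommGroup E] [NormedSpace ℝ E]
    [NormedAddCommGroup F] [NormedSpace ℝ F] (L : E →L[ℝ] F) {n : WithTop ℕ∞} {g : ℝ → E}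
    {s : Set ℝ} {t : ℝ} (hg : ContDiffOn ℝ n g s) (hs : UniqueDiffOn ℝ s) (ht : t ∈ s) {i : ℕ}
    (hi : i ≤ n) :
    iteratedDerivWithin i (fun τ => L (g τ)) s t = L (iteratedDerivWithin i g s t) := by
  have := L.iteratedFDerivWithin_comp_left (hg t ht) hs ht hi
  rw [iteratedDerivWithin_eq_iteratedFDerivWithin, iteratedDerivWithin_eq_iteratedFDerivWithin]
  change iteratedFDerivWithin ℝ i (L ∘ g) s t _ = _
  rw [this]
  rfl

/-- The leap probabilities are smooth in the step size, and can be differentiated term by term. -/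
lemma IsPoissonBinomialMethod.leapProb_deriv (hδ : 0 < δ) (hκ : IsPoissonBinomialMethod q δ S κ)
    (ν : Fin M → State N) {x : State N} (hx : x ∈ S) (x' : State N) :
    ContDiffOn ℝ ((q + 1 : ℕ) : ℕ∞) (fun τ => leapProb ν κ τ x x') (Icc 0 δ) ∧
    ∀ i ≤ q + 1, iteratedDerivWithin i (fun τ => leapProb ν κ τ x x') (Icc 0 δ) 0 =
      ∑' k, {k | shift ν x k = x'}.indicator
        (fun k => iteratedDerivWithin i (fun τ => countProb κ τ x k) (Icc 0 δ) 0) k := by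
  obtain ⟨g, hg, hgk⟩ := hκ.exists_contDiffOn_lOne hx
  have hs : UniqueDiffOn ℝ (Icc 0 δ) := uniqueDiffOn_Icc hδ
  have h0 : (0 : ℝ) ∈ Icc 0 δ := ⟨le_rfl, hδ.le⟩
  -- Both the fibre sum and each single coordinate are continuous linear functionals of the one
  -- curve `g`, so derivatives commute with both.
  have hleap : EqOn (fun τ => leapProb ν κ τ x x')
      (fun τ => sumOn {k | shift ν x k = x'} (g τ)) (Icc 0 δ) := by
    intro τ hτ
    dsimp only
    rw [leapProb_eq_tsum hκ ν hx hτ, sumOn_apply]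
    congr! 3 with k
    exact funext fun k => (hgk τ hτ k).symm
  have hcount : ∀ k, EqOn (fun τ => countProb κ τ x k)
      (fun τ => lp.evalCLM ℝ (fun _ : Counts M => ℝ) 1 k (g τ)) (Icc 0 δ) :=
    fun k τ hτ => (hgk τ hτ k).symm
  refine ⟨((sumOn _).contDiff.comp_contDiffOn hg).congr hleap, fun i hi => ?_⟩
  have hi' : (i : WithTop ℕ∞) ≤ (((q + 1 : ℕ) : ℕ∞) : WithTop ℕ∞) := by exact_mod_cast hi
  rw [iteratedDerivWithin_congr hleap h0, iteratedDerivWithin_clm_comp _ hg hs h0 hi',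
    sumOn_apply]
  refine tsum_congr fun k => congrFun (congrArg _ (funext fun k => ?_)) k
  rw [iteratedDerivWithin_congr (hcount k) h0, iteratedDerivWithin_clm_comp _ hg hs h0 hi']
  rfl

end Leap

/-! ### Powers of the generator of the reaction counts -/

section Generator

variable {N M : ℕ}

/-- The generator of the chemical process, acting on functions of the state. -/
def generator (ν : Fin M → State N) (a : Fin M → State N → ℝ) (f : State N → ℝ) (x : State N) :
    ℝ :=
  ∑ j, a j x * f (x + ν j) - totalPropensity a x * f x

lemma shift_add_single (ν : Fin M → State N) (x : State N) (k : Counts M) (j : Fin M) :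
    shift ν x (k + Pi.single j 1) = shift ν x k + ν j := by
  simp only [shift, Pi.add_apply, add_smul, Finset.sum_add_distrib, add_assoc]
  congr 2
  rw [Finset.sum_eq_single j] <;> simp +contextual

/-- The map `shift ν x` intertwines the count generator with the generator on states; this is the
one-step case of the next power formula. -/
lemma hasSum_countGenerator_mul (ν : Fin M → State N) (a : Fin M → State N → ℝ) (x : State N)
    (l : Counts M) (f : State N → ℝ) :
    HasSum (fun k => countGenerator ν a x l k * f (shift ν x k))
      (generator ν a f (shift ν x l)) := by
  have h1 : ∀ j : Fin M, HasSum (fun k : Counts M =>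
      if k = l + Pi.single j 1 then a j (shift ν x l) * f (shift ν x k) else 0)
      (a j (shift ν x l) * f (shift ν x l + ν j)) := by
    intro j
    have := hasSum_single (l + Pi.single j 1) (f := fun k : Counts M =>
      if k = l + Pi.single j 1 then a j (shift ν x l) * f (shift ν x k) else 0)
      (fun k hk => if_neg hk)
    simpa [shift_add_single] using this
  have h2 : HasSum (fun k : Counts M =>
      if k = l then totalPropensity a (shift ν x l) * f (shift ν x k) else 0)
      (totalPropensity a (shift ν x l) * f (shift ν x l)) := by
    have := hasSum_single l (f := fun k : Counts M =>
      if k = l then totalPropensity a (shift ν x l) * f (shift ν x k) else 0)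
      (fun k hk => if_neg hk)
    simpa using this
  refine ((hasSum_sum fun j _ => h1 j).sub h2).congr_fun fun k => ?_
  simp only [countGenerator, sub_mul, Finset.sum_mul, ite_mul, zero_mul]

lemma finite_support_countGenerator (ν : Fin M → State N) (a : Fin M → State N → ℝ) (x : State N)
    (l : Counts M) : (Function.support (countGenerator ν a x l)).Finite := by
  refine ((Set.finite_range fun j : Fin M => l + Pi.single j 1).insert l).subset fun k hk => ?_
  by_contra h
  simp only [mem_insert_iff, mem_range, not_or, not_exists] at h
  refine hk ?_
  have h1 : ∀ j : Fin M, k ≠ l + Pi.single j 1 := fun j hj => h.2 j hj.symm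
  simp [countGenerator, h1, h.1]

/-- `matPow` multiplies on the right, so the extra factor acts on `f` first and the induction must
cover all `f`. Finite support of the row is carried along to justify interchanging the sums. -/
lemma matPow_countGenerator (ν : Fin M → State N) (a : Fin M → State N → ℝ) (x : State N) (i : ℕ) :
    (Function.support (matPow (countGenerator ν a x) i 0)).Finite ∧
    ∀ f : State N → ℝ, HasSum (fun k => matPow (countGenerator ν a x) i 0 k * f (shift ν x k))
      ((generator ν a)^[i] f x) := by
  induction i with
  | zero =>
    refine ⟨(Set.finite_singleton (0 : Counts M)).subset fun k hk => ?_, fun f => ?_⟩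
    · by_contra h
      exact hk (if_neg fun h' => h h'.symm)
    · have := hasSum_single (0 : Counts M) (f := fun k : Counts M =>
        matPow (countGenerator ν a x) 0 0 k * f (shift ν x k)) (fun k hk => by
          simp [matPow, hk.symm])
      simpa [matPow, shift] using this
  | succ i ih =>
    obtain ⟨hfin, hsum⟩ := ih
    have hsucc : ∀ k, matPow (countGenerator ν a x) (i + 1) 0 k =
        ∑ l ∈ hfin.toFinset, matPow (countGenerator ν a x) i 0 l * countGenerator ν a x l k := by
      intro k
      refine finsum_eq_sum_of_support_subset _ fun l hl => ?_
      simp only [Finite.coe_toFinset]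
      exact left_ne_zero_of_mul hl
    refine ⟨(hfin.toFinset.finite_toSet.biUnion fun l _ =>
      finite_support_countGenerator ν a x l).subset fun k hk => ?_, fun f => ?_⟩
    · rw [Function.mem_support, hsucc] at hk
      obtain ⟨l, hl, hne⟩ := Finset.exists_ne_zero_of_sum_ne_zero hk
      exact mem_biUnion hl (right_ne_zero_of_mul hne)
    · have h1 := hasSum_sum (s := hfin.toFinset) fun l _ =>
        (hasSum_countGenerator_mul ν a x l f).mul_left (matPow (countGenerator ν a x) i 0 l)
      have h2 := hasSum_sum_of_ne_finset_zero (L := .unconditional _)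
        (f := fun l => matPow (countGenerator ν a x) i 0 l * generator ν a f (shift ν x l))
        (s := hfin.toFinset) (fun l hl => by
          have : matPow (countGenerator ν a x) i 0 l = 0 := by simpa using hl
          rw [this, zero_mul])
      rw [Function.iterate_succ_apply, (hsum (generator ν a f)).unique h2]
      refine h1.congr_fun fun k => ?_
      rw [hsucc, Finset.sum_mul]
      exact Finset.sum_congr rfl fun l _ => mul_assoc _ _ _

lemma tsum_indicator_matPow (ν : Fin M → State N) (a : Fin M → State N → ℝ) (x x' : State N)
    (i : ℕ) :
    ∑' k, {k | shift ν x k = x'}.indicator (matPow (countGenerator ν a x) i 0) k =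
      (generator ν a)^[i] (fun y => if y = x' then 1 else 0) x := by
  rw [← ((matPow_countGenerator ν a x i).2 _).tsum_eq]
  refine tsum_congr fun k => ?_
  simp [indicator_apply]

end Generator

/-! ### Laws of finite reaction histories -/

section History

variable {N M : ℕ}

lemma totalPropensity_nonneg {a : Fin M → State N → ℝ} (ha : ∀ j x, 0 ≤ a j x) (x : State N) :
    0 ≤ totalPropensity a x := Finset.sum_nonneg fun j _ => ha j x

lemma measurable_comp_const_sub {u : ℝ → ℝ≥0∞} (hu : Measurable u) (t : ℝ) :
    Measurable fun s => u (t - s) :=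
  hu.comp (measurable_const.sub measurable_id)

/-- The law of the next waiting time in the state `x`, restricted to the event that the next
reaction is `j`. -/
noncomputable def stepMeasure (a : Fin M → State N → ℝ) (x : State N) (j : Fin M) : Measure ℝ :=
  (volume.restrict (Ici 0)).withDensity
    fun s => ENNReal.ofReal (a j x * Real.exp (-(totalPropensity a x) * s))

instance (a : Fin M → State N → ℝ) (x : State N) (j : Fin M) : SigmaFinite (stepMeasure a x j) :=
  SigmaFinite.withDensity _

lemma lintegral_stepMeasure_eq (a : Fin M → State N → ℝ) (x : State N) (j : Fin M)
    {u : ℝ → ℝ≥0∞} (hu : Measurable u) :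
    ∫⁻ s, u s ∂stepMeasure a x j =
      ∫⁻ s in Ioi 0, ENNReal.ofReal (a j x * Real.exp (-(totalPropensity a x) * s)) * u s := by
  rw [stepMeasure, lintegral_withDensity_eq_lintegral_mul _ (by fun_prop) hu,
    setLIntegral_congr Ioi_ae_eq_Ici]
  rfl

lemma stepMeasure_Ici {a : Fin M → State N → ℝ} (ha : ∀ j x, 0 ≤ a j x) (x : State N) (j : Fin M)
    (t : ℝ) : stepMeasure a x j (Ici t) = ENNReal.ofReal
      (a j x / totalPropensity a x * Real.exp (-(totalPropensity a x) * max t 0)) := by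
  have h1 : stepMeasure a x j (Ici t) =
      ∫⁻ s in Ioi (max t 0), ENNReal.ofReal (a j x * Real.exp (-(totalPropensity a x) * s)) := by
    rw [stepMeasure, withDensity_apply _ measurableSet_Ici, Measure.restrict_restrict
      measurableSet_Ici, Ici_inter_Ici, setLIntegral_congr Ioi_ae_eq_Ici]
  rw [h1]
  -- In an absorbing state every `a j x` is zero, and both sides vanish by the convention `0 / 0 =
  -- 0`.
  rcases (totalPropensity_nonneg ha x).eq_or_lt with h0 | h0
  · have : a j x = 0 := (Finset.sum_eq_zero_iff_of_nonneg fun j _ => ha j x).1 h0.symm j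
      (Finset.mem_univ j)
    simp [this]
  · rw [← ofReal_integral_eq_lintegral_ofReal, integral_const_mul,
      integral_exp_mul_Ioi (neg_lt_zero.2 h0)]
    · congr 1
      field_simp
    · exact (integrableOn_exp_mul_Ioi (neg_lt_zero.2 h0) _).const_mul _
    · exact Filter.Eventually.of_forall fun s => mul_nonneg (ha j x) (Real.exp_nonneg _)

/-- Vanishing of `u` at negative times cuts the integral off at `t`; the bound `u ≤ 1` gives the
integrability needed to pass to real integrals. -/
lemma lintegral_stepMeasure_sub {a : Fin M → State N → ℝ} (ha : ∀ j x, 0 ≤ a j x) (x : State N)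
    (j : Fin M) {u : ℝ → ℝ≥0∞} (hu : Measurable u) (h0 : ∀ t < 0, u t = 0) (h1 : ∀ t, u t ≤ 1)
    {t : ℝ} (ht : 0 ≤ t) :
    ∫⁻ s, u (t - s) ∂stepMeasure a x j = ENNReal.ofReal
      (∫ s in 0..t, a j x * Real.exp (-(totalPropensity a x) * s) * (u (t - s)).toReal) := by
  have hint : IntervalIntegrable
      (fun s => a j x * Real.exp (-(totalPropensity a x) * s) * (u (t - s)).toReal) volume 0 t := by
    have hb : IntervalIntegrable (fun s => (u (t - s)).toReal) volume 0 t := by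
      rw [intervalIntegrable_iff]
      refine Measure.integrableOn_of_bounded (M := 1) (by simp) ?_ ?_
      · exact ((measurable_comp_const_sub hu t).ennreal_toReal).aestronglyMeasurable
      · refine Filter.Eventually.of_forall fun s => ?_
        rw [Real.norm_of_nonneg ENNReal.toReal_nonneg]
        exact ENNReal.toReal_le_of_le_ofReal zero_le_one (by simpa using h1 _)
    exact hb.continuousOn_mul (by fun_prop)
  rw [lintegral_stepMeasure_eq a x j (measurable_comp_const_sub hu t),
    intervalIntegral.integral_of_le ht, ofReal_integral_eq_lintegral_ofReal
      ((intervalIntegrable_iff_integrableOn_Ioc_of_le ht).1 hint)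
      (Filter.Eventually.of_forall fun s => mul_nonneg (mul_nonneg (ha j x) (Real.exp_nonneg _))
        ENNReal.toReal_nonneg),
    ← lintegral_indicator measurableSet_Ioi, ← lintegral_indicator measurableSet_Ioc]
  refine lintegral_congr fun s => ?_
  by_cases hs : 0 < s
  · by_cases hst : s ≤ t
    · rw [indicator_of_mem (mem_Ioi.2 hs), indicator_of_mem (mem_Ioc.2 ⟨hs, hst⟩),
        ENNReal.ofReal_mul (mul_nonneg (ha j x) (Real.exp_nonneg _)),
        ENNReal.ofReal_toReal ((h1 _).trans_lt ENNReal.one_lt_top).ne]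
    · rw [indicator_of_mem (mem_Ioi.2 hs), indicator_of_notMem (fun h => hst h.2),
        h0 _ (by linarith), mul_zero]
  · rw [indicator_of_notMem (show s ∉ Ioi 0 from hs), indicator_of_notMem (fun h => hs h.1)]

/-- The state reached from `x` after the reactions in the list `l`. -/
def endState (ν : Fin M → State N) (x : State N) (l : List (Fin M)) : State N := x + (l.map ν).sum

/-- The `base` functional of the state and the remaining time after the reactions in the list `l`,
averaged over the waiting times. -/
noncomputable def historyLaw (ν : Fin M → State N) (a : Fin M → State N → ℝ)
    (base : State N → ℝ → ℝ≥0∞) : List (Fin M) → State N → ℝ → ℝ≥0∞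
  | [], x, t => base x t
  | j :: l, x, t => ∫⁻ s, historyLaw ν a base l (x + ν j) (t - s) ∂stepMeasure a x j

variable {ν : Fin M → State N} {a : Fin M → State N → ℝ}

lemma measurable_historyLaw {base : State N → ℝ → ℝ≥0∞} (hb : ∀ x, Measurable (base x))
    (l : List (Fin M)) (x : State N) : Measurable (historyLaw ν a base l x) := by
  induction l generalizing x with
  | nil => exact hb x
  | cons j l ih =>
    exact Measurable.lintegral_prod_right' (f := fun p : ℝ × ℝ =>
      historyLaw ν a base l (x + ν j) (p.1 - p.2)) ((ih _).comp measurable_sub)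

lemma lintegral_stepMeasure_eq_zero (x : State N) (j : Fin M) {u : ℝ → ℝ≥0∞} (hu : Measurable u)
    (h0 : ∀ t < 0, u t = 0) {t : ℝ} (ht : t < 0) : ∫⁻ s, u (t - s) ∂stepMeasure a x j = 0 := by
  rw [lintegral_stepMeasure_eq a x j (measurable_comp_const_sub hu t)]
  rw [setLIntegral_congr_fun measurableSet_Ioi (g := fun _ => 0), lintegral_zero]
  intro s hs
  simp [h0 (t - s) (by linarith [mem_Ioi.1 hs])]

lemma historyLaw_of_neg {base : State N → ℝ → ℝ≥0∞} (hb : ∀ x, Measurable (base x))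
    (h0 : ∀ x, ∀ t < 0, base x t = 0) (l : List (Fin M)) (x : State N) {t : ℝ} (ht : t < 0) :
    historyLaw ν a base l x t = 0 := by
  induction l generalizing x t with
  | nil => exact h0 x t ht
  | cons j l ih =>
    exact lintegral_stepMeasure_eq_zero x j (measurable_historyLaw hb l _) (fun t ht => ih _ ht) ht

/-- The base functional `1` for nonnegative remaining time. -/
noncomputable def arrived (_ : State N) (t : ℝ) : ℝ≥0∞ := if 0 ≤ t then 1 else 0

/-- The probability that no reaction occurs during the remaining time. -/
noncomputable def waiting (a : Fin M → State N → ℝ) (x : State N) (t : ℝ) : ℝ≥0∞ :=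
  if 0 ≤ t then ENNReal.ofReal (Real.exp (-(totalPropensity a x) * t)) else 0

lemma measurable_arrived (x : State N) : Measurable (arrived x) :=
  Measurable.ite measurableSet_Ici measurable_const measurable_const

lemma measurable_waiting (x : State N) : Measurable (waiting a x) :=
  Measurable.ite measurableSet_Ici (by fun_prop) measurable_const

/-- For `t ≥ 0` this is `1 = exp(-a₀ t) + ∫₀ᵗ a₀ exp(-a₀ s) ds`, with `a₀` split over the channels.
-/
lemma arrived_eq (ha : ∀ j x, 0 ≤ a j x) (x : State N) (t : ℝ) :
    arrived x t = waiting a x t + ∑ j, ∫⁻ s, arrived (x + ν j) (t - s) ∂stepMeasure a x j := by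
  by_cases ht : 0 ≤ t
  · have h1 : ∀ j, ∫⁻ s, arrived (x + ν j) (t - s) ∂stepMeasure a x j = ENNReal.ofReal
        (∫ s in 0..t, a j x * Real.exp (-(totalPropensity a x) * s)) := by
      intro j
      rw [lintegral_stepMeasure_sub ha x j (measurable_arrived _)
        (fun t ht => if_neg (not_le.2 ht)) (fun t => by unfold arrived; split_ifs <;> simp) ht]
      congr 1
      refine intervalIntegral.integral_congr fun s hs => ?_
      rw [uIcc_of_le ht] at hs
      simp [arrived, hs.2]
    have h2 : ∀ j, 0 ≤ ∫ s in 0..t, a j x * Real.exp (-(totalPropensity a x) * s) := fun j =>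
      intervalIntegral.integral_nonneg ht fun s _ => mul_nonneg (ha j x) (Real.exp_nonneg _)
    have h3 : ∑ j, ∫ s in 0..t, a j x * Real.exp (-(totalPropensity a x) * s) =
        1 - Real.exp (-(totalPropensity a x) * t) := by
      rw [← intervalIntegral.integral_finsetSum fun j _ => by
        apply Continuous.intervalIntegrable; fun_prop]
      have h4 := intervalIntegral.integral_eq_sub_of_hasDerivAt (a := 0) (b := t)
        (f := fun s => -Real.exp (-(totalPropensity a x) * s))
        (f' := fun s => ∑ j, a j x * Real.exp (-(totalPropensity a x) * s)) (fun s _ => by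
          have h5 := (((hasDerivAt_id s).const_mul (-(totalPropensity a x))).exp).neg
          convert! h5 using 1
          rw [← Finset.sum_mul]
          simp only [id, totalPropensity]
          ring) (by apply Continuous.intervalIntegrable; fun_prop)
      rw [h4]
      simp
      ring
    simp only [h1]
    rw [← ENNReal.ofReal_sum_of_nonneg fun j _ => h2 j, h3, arrived, waiting, if_pos ht, if_pos ht,
      ← ENNReal.ofReal_add (Real.exp_nonneg _)]
    · simp
    · rw [← h3]; exact Finset.sum_nonneg fun j _ => h2 j
  · simp only [arrived, waiting, if_neg ht, zero_add]
    refine (Finset.sum_eq_zero fun j _ => ?_).symm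
    exact lintegral_stepMeasure_eq_zero x j (measurable_arrived (x + ν j))
      (fun t ht => if_neg (not_le.2 ht)) (not_le.1 ht)

/-- After the reactions in `l`, either no further reaction occurs, or some reaction `j` does. -/
lemma historyLaw_arrived_eq (ha : ∀ j x, 0 ≤ a j x) (l : List (Fin M)) (x : State N) (t : ℝ) :
    historyLaw ν a arrived l x t =
      historyLaw ν a (waiting a) l x t + ∑ j, historyLaw ν a arrived (l ++ [j]) x t := by
  induction l generalizing x t with
  | nil => exact arrived_eq ha x t
  | cons i l ih =>
    have hm : ∀ (base : State N → ℝ → ℝ≥0∞) (_ : ∀ x, Measurable (base x)) (l : List (Fin M)),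
        Measurable fun s => historyLaw ν a base l (x + ν i) (t - s) := fun base hb l =>
      measurable_comp_const_sub (measurable_historyLaw hb l _) t
    simp only [historyLaw, List.cons_append]
    rw [← lintegral_finsetSum _ fun j _ => hm _ measurable_arrived _,
      ← lintegral_add_left (hm _ measurable_waiting _)]
    exact lintegral_congr fun s => ih _ _

lemma tsum_list_eq {α : Type*} (F : List α → ℝ≥0∞) :
    ∑' l, F l = F [] + ∑' p : α × List α, F (p.1 :: p.2) := by
  classical
  rw [ENNReal.tsum_eq_add_tsum_ite []]
  congr 1
  have hinj : Function.Injective fun p : α × List α => p.1 :: p.2 := by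
    rintro ⟨a, l⟩ ⟨b, m⟩ h
    simpa using h
  refine (hinj.tsum_eq fun l hl => ?_).symm.trans ?_
  · cases l with
    | nil => simp at hl
    | cons a l => exact ⟨(a, l), rfl⟩
  · simp only [reduceCtorEq, if_false]

open Classical in
/-- The sum of the probabilities of the histories that lead from `x` to `x'` up to time `t`. -/
noncomputable def historySum (ν : Fin M → State N) (a : Fin M → State N → ℝ) (x' x : State N)
    (t : ℝ) : ℝ≥0∞ :=
  ∑' l : List (Fin M), if endState ν x l = x' then historyLaw ν a (waiting a) l x t else 0

lemma measurable_historySum (x' x : State N) : Measurable (historySum ν a x' x) :=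
  Measurable.tsum fun l => by
    split_ifs
    exacts [measurable_historyLaw measurable_waiting l x, measurable_const]

lemma historySum_of_neg (x' x : State N) {t : ℝ} (ht : t < 0) : historySum ν a x' x t = 0 := by
  refine ENNReal.tsum_eq_zero.2 fun l => ?_
  rw [historyLaw_of_neg measurable_waiting (fun x t ht => if_neg (not_le.2 ht)) l x ht, ite_self]

/-- The decomposition at the first reaction. -/
lemma historySum_eq (x' x : State N) (t : ℝ) :
    historySum ν a x' x t = (if x = x' then waiting a x t else 0) +
      ∑ j, ∫⁻ s, historySum ν a x' (x + ν j) (t - s) ∂stepMeasure a x j := by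
  classical
  rw [historySum, tsum_list_eq, ENNReal.tsum_prod', tsum_fintype]
  congr 1
  · simp [endState, historyLaw]
  · refine Finset.sum_congr rfl fun j _ => ?_
    unfold historySum
    rw [lintegral_tsum fun l => ?_]
    · refine tsum_congr fun l => ?_
      have : endState ν (x + ν j) l = endState ν x (j :: l) := by simp [endState, add_assoc]
      rw [this]
      split_ifs
      · rfl
      · simp
    · have := measurable_comp_const_sub (measurable_historyLaw (ν := ν) (a := a)
        (base := waiting a) measurable_waiting l (x + ν j)) t
      split_ifs
      exacts [this.aemeasurable, aemeasurable_const]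

end History

/-! ### The histories of the chemical chain -/

section Paths

variable {N M : ℕ} {Ω : Type*} {ν : Fin M → State N} {x : State N} {W : ℕ → Ω → ℝ≥0∞}
  {J : ℕ → Ω → Fin M}

lemma sum_map_list_range {A : Type*} [AddCommMonoid A] (f : ℕ → A) (n : ℕ) :
    ((List.range n).map f).sum = ∑ i ∈ Finset.range n, f i := by
  induction n with
  | zero => simp
  | succ n ih => simp [List.range_succ, Finset.sum_range_succ, ih]

/-- The list of the first `n` reactions. -/
def history (J : ℕ → Ω → Fin M) (n : ℕ) (ω : Ω) : List (Fin M) :=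
  (List.range n).map fun i => J i ω

@[simp] lemma length_history (n : ℕ) (ω : Ω) : (history J n ω).length = n := by simp [history]

lemma history_succ (n : ℕ) (ω : Ω) : history J (n + 1) ω = history J n ω ++ [J n ω] := by
  simp [history, List.range_succ]

/-- The law of the chain is stated for infinite channel sequences, so `l` is continued by a default
`j₀`, which is never read below `l.length`. -/
lemma history_eq_iff (j₀ : Fin M) (l : List (Fin M)) (ω : Ω) :
    history J l.length ω = l ↔ ∀ i < l.length, J i ω = l.getD i j₀ := by
  constructor
  · intro h i hi
    have h1 : (history J l.length ω).getD i j₀ = l.getD i j₀ := by rw [h]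
    rw [← h1]
    simp [history, hi]
  · intro h
    refine List.ext_getElem (by simp) fun i h1 h2 => ?_
    simpa [history, h2] using h i h2

/-- The event that the first reactions are those in `l`, and that they occur up to time `t`. -/
def occurred (W : ℕ → Ω → ℝ≥0∞) (J : ℕ → Ω → Fin M) (l : List (Fin M)) (t : ℝ) : Set Ω :=
  {ω | history J l.length ω = l ∧ ∑ i ∈ Finset.range l.length, W i ω ≤ ENNReal.ofReal t}

/-- The event that the reactions up to time `t` are those in `l`. -/
def exactly (W : ℕ → Ω → ℝ≥0∞) (J : ℕ → Ω → Fin M) (l : List (Fin M)) (t : ℝ) : Set Ω :=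
  {ω | ω ∈ occurred W J l t ∧
    ENNReal.ofReal t < ∑ i ∈ Finset.range (l.length + 1), W i ω}

/-- On this event the reactions fired by time `t` are those with index below `l.length`; grouping
them by channel yields the counts. -/
lemma reactionCount_of_mem_exactly {l : List (Fin M)} {t : ℝ} {ω : Ω}
    (hω : ω ∈ exactly W J l t) : shift ν x (reactionCount W J t ω) = endState ν x l := by
  have hset : ∀ n, reactionTime W n ω ≤ ENNReal.ofReal t ↔ n < l.length := by
    intro n
    constructor
    · intro hn
      by_contra hlt
      refine absurd hω.2 (not_lt.2 (le_trans ?_ hn))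
      exact Finset.sum_le_sum_of_subset (Finset.range_mono (by omega))
    · intro hn
      exact (Finset.sum_le_sum_of_subset (Finset.range_mono (by omega))).trans hω.1.2
  have hcount : ∀ j, reactionCount W J t ω j =
      ((Finset.range l.length).filter fun i => J i ω = j).card := by
    intro j
    rw [reactionCount, ← Set.ncard_coe_finset]
    congr 1
    ext n
    simp [hset]
  have hl : l.map ν = (List.range l.length).map fun i => ν (J i ω) := by
    conv_lhs => rw [← hω.1.1]
    simp [history, Function.comp_def]
  rw [shift, endState, hl, sum_map_list_range]
  congr 1
  rw [← Finset.sum_fiberwise (Finset.range l.length) (fun i => J i ω)]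
  refine Finset.sum_congr rfl fun j _ => ?_
  rw [hcount, Finset.sum_congr rfl (g := fun _ => ν j) (fun i hi => by
    rw [(Finset.mem_filter.1 hi).2]), Finset.sum_const]

/-- The list consists of the reactions before the first index whose reaction time exceeds `t`. -/
lemma exists_mem_exactly {t : ℝ} {ω : Ω}
    (hfin : {n | reactionTime W n ω ≤ ENNReal.ofReal t}.Finite) :
    ∃ l, ω ∈ exactly W J l t := by
  classical
  have hex : ∃ n, ENNReal.ofReal t < reactionTime W n ω := by
    by_contra! h
    exact Set.infinite_univ (hfin.subset fun n _ => h n)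
  refine ⟨history J (Nat.find hex) ω, ⟨by simp, ?_⟩, ?_⟩
  · rw [length_history]
    rcases Nat.eq_zero_or_pos (Nat.find hex) with h0 | h0
    · simp [h0]
    · have := not_lt.1 (Nat.find_min hex (Nat.sub_one_lt h0.ne'))
      rwa [reactionTime, Nat.sub_add_cancel h0] at this
  · rw [length_history]
    exact Nat.find_spec hex

/-- If `l'` were shorter than `l`, the wait that overshoots `t` for `l'` would be among those that
`l` fits into `[0, t]`. Equal lengths force equal histories. -/
lemma exactly_disjoint (t : ℝ) : Pairwise (Function.onFun Disjoint fun l => exactly W J l t) := by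
  have key : ∀ (l l' : List (Fin M)) (ω : Ω), ω ∈ exactly W J l t → ω ∈ exactly W J l' t →
      l.length ≤ l'.length := by
    intro l l' ω h1 h2
    by_contra! hlt
    refine absurd h2.2 (not_lt.2 (le_trans ?_ h1.1.2))
    exact Finset.sum_le_sum_of_subset (Finset.range_mono hlt)
  intro l l' hne
  refine Set.disjoint_left.2 fun ω h1 h2 => hne ?_
  rw [← h1.1.1, ← h2.1.1, le_antisymm (key l l' ω h1 h2) (key l' l ω h2 h1)]

end Paths

/-! ### Probabilities of histories under the law of the chain -/

section Chain

variable {N M : ℕ} {Ω : Type*} [MeasurableSpace Ω] {ν : Fin M → State N}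
  {a : Fin M → State N → ℝ} {x : State N} {μ : Measure Ω} {W : ℕ → Ω → ℝ≥0∞} {J : ℕ → Ω → Fin M}

lemma chainState_succ (ν : Fin M → State N) (x : State N) (j : ℕ → Fin M) (n : ℕ) :
    chainState ν x j (n + 1) = chainState ν (x + ν (j 0)) (fun i => j (i + 1)) n := by
  rw [chainState, chainState, Finset.sum_range_succ']
  abel

/-- The defining law covers only thresholds `t i ≥ 0`; replacing `t i` by `max (t i) 0` changes
neither side, as waits are nonnegative. -/
lemma IsChemicalChain.measure_box (ha : ∀ j x, 0 ≤ a j x) (h : IsChemicalChain ν a x μ W J)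
    (n : ℕ) (j : ℕ → Fin M) (t : ℕ → ℝ) :
    μ {ω | ∀ i < n, (J i ω = j i ∧ W i ω < ∞) ∧ t i ≤ (W i ω).toReal} =
      ∏ i ∈ Finset.range n, stepMeasure a (chainState ν x j i) (j i) (Ici (t i)) := by
  have h1 := h.law n j (fun i => max (t i) 0) (fun i => le_max_right _ _)
  have h2 : {ω | ∀ i < n, (J i ω = j i ∧ W i ω < ∞) ∧ t i ≤ (W i ω).toReal} =
      {ω | ∀ i < n, J i ω = j i ∧ ENNReal.ofReal (max (t i) 0) ≤ W i ω ∧ W i ω < ∞} := by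
    ext ω
    refine forall₂_congr fun i _ => ?_
    constructor
    · rintro ⟨⟨h1, h2⟩, h3⟩
      exact ⟨h1, (ENNReal.ofReal_le_iff_le_toReal h2.ne).2 (max_le h3 ENNReal.toReal_nonneg), h2⟩
    · rintro ⟨h1, h2, h3⟩
      exact ⟨⟨h1, h3⟩, (le_max_left _ _).trans ((ENNReal.ofReal_le_iff_le_toReal h3.ne).1 h2)⟩
  rw [h2, h1, ENNReal.ofReal_prod_of_nonneg]
  · exact Finset.prod_congr rfl fun i _ => (stepMeasure_Ici ha _ _ _).symm
  · exact fun i _ => mul_nonneg (div_nonneg (ha _ _) (totalPropensity_nonneg ha _))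
      (Real.exp_nonneg _)

/-- Given the channels, the waiting times are independent and exponentially distributed. -/
lemma IsChemicalChain.pi_eq_map (ha : ∀ j x, 0 ≤ a j x) (h : IsChemicalChain ν a x μ W J)
    (n : ℕ) (j : ℕ → Fin M) :
    Measure.pi (fun i : Fin n => stepMeasure a (chainState ν x j i) (j i)) =
      (μ.restrict {ω | ∀ i < n, J i ω = j i ∧ W i ω < ∞}).map
        (fun ω (i : Fin n) => (W i ω).toReal) := by
  have hmeas : Measurable fun ω (i : Fin n) => (W i ω).toReal :=
    measurable_pi_lambda _ fun i => (h.measurable_wait i).ennreal_toReal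
  -- Half-lines `[t, ∞)` form a generating π-system, and the sets `[-k, ∞)` exhaust the line with
  -- finite mass, so tails determine the product measure.
  refine Measure.pi_eq_generateFrom (C := fun _ => range Ici) (fun _ => ?_)
    (fun _ => isPiSystem_Ici) (fun i => ⟨fun k : ℕ => Ici (-(k : ℝ)), fun k => ⟨_, rfl⟩,
      fun k => ?_, ?_⟩) ?_
  · rw [← borel_eq_generateFrom_Ici, BorelSpace.measurable_eq (α := ℝ)]
  · rw [stepMeasure_Ici ha]
    exact ENNReal.ofReal_lt_top
  · refine eq_univ_of_forall fun t => mem_iUnion.2 ?_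
    obtain ⟨k, hk⟩ := exists_nat_ge (-t)
    exact ⟨k, by simp only [mem_Ici]; linarith⟩
  · intro s hs
    choose t ht using hs
    have hs' : s = fun i => Ici (t i) := funext fun i => (ht i).symm
    have hbox := h.measure_box ha n j (fun i => if hi : i < n then t ⟨i, hi⟩ else 0)
    rw [Finset.prod_range] at hbox
    rw [Measure.map_apply hmeas (MeasurableSet.univ_pi fun i => by
      rw [hs']; exact measurableSet_Ici), Measure.restrict_apply (hmeas (MeasurableSet.univ_pi
        fun i => by rw [hs']; exact measurableSet_Ici))]
    convert! hbox using 2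
    · ext ω
      simp only [hs', mem_inter_iff, mem_preimage, mem_pi, mem_univ, true_imp_iff, mem_Ici,
        mem_ofPred_eq]
      constructor
      · rintro ⟨h1, h2⟩ i hi
        exact ⟨h2 i hi, by simpa [hi] using h1 ⟨i, hi⟩⟩
      · intro h1
        refine ⟨fun i => ?_, fun i hi => (h1 i hi).1⟩
        simpa using (h1 i i.2).2
    · simp [hs']

/-- Separating the first waiting time by Fubini reproduces the recursion of `historyLaw`. -/
lemma pi_stepMeasure_sum_le (j₀ : Fin M) (l : List (Fin M)) (x : State N) (t : ℝ) :
    Measure.pi (fun i : Fin l.length =>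
      stepMeasure a (chainState ν x (fun i => l.getD i j₀) i) (l.getD i j₀)) {y | ∑ i, y i ≤ t} =
      historyLaw ν a arrived l x t := by
  induction l generalizing x t with
  | nil =>
    have : IsEmpty (Fin ([] : List (Fin M)).length) := Fin.isEmpty'
    rw [Measure.pi_of_empty]
    by_cases ht : 0 ≤ t <;> simp [historyLaw, arrived, ht]
  | cons j l ih =>
    set m : Fin (l.length + 1) → Measure ℝ := fun i =>
      stepMeasure a (chainState ν x (fun i => (j :: l).getD i j₀) i) ((j :: l).getD i j₀) with hm
    have : ∀ i, SigmaFinite (m i) := fun i => by rw [hm]; infer_instance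
    have hpres := measurePreserving_piFinSuccAbove m 0
    have hset : {y : Fin (l.length + 1) → ℝ | ∑ i, y i ≤ t} =
        MeasurableEquiv.piFinSuccAbove (fun _ : Fin (l.length + 1) => ℝ) 0 ⁻¹'
          {p : ℝ × (Fin l.length → ℝ) | p.1 + ∑ i, p.2 i ≤ t} := by
      ext y
      simp [Fin.sum_univ_succ, MeasurableEquiv.piFinSuccAbove, Fin.insertNthEquiv,
        Fin.tail]
    have hms : MeasurableSet {p : ℝ × (Fin l.length → ℝ) | p.1 + ∑ i, p.2 i ≤ t} :=
      measurableSet_le (by fun_prop) measurable_const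
    change Measure.pi m {y : Fin (l.length + 1) → ℝ | ∑ i, y i ≤ t} = _
    rw [hset, hpres.measure_preimage hms.nullMeasurableSet, Measure.prod_apply hms, historyLaw]
    have h0 : m 0 = stepMeasure a x j := by simp [hm, chainState]
    have hs : (fun i : Fin l.length => m (Fin.succAbove 0 i)) = fun i : Fin l.length =>
        stepMeasure a (chainState ν (x + ν j) (fun i => l.getD i j₀) i) (l.getD i j₀) := by
      funext i
      simp [hm, chainState_succ]
    rw [h0, hs]
    refine lintegral_congr fun s => ?_
    rw [← ih]
    congr 1
    ext y
    simp [le_sub_iff_add_le']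

lemma IsChemicalChain.measurableSet_occurred (h : IsChemicalChain ν a x μ W J)
    (l : List (Fin M)) (t : ℝ) : MeasurableSet (occurred W J l t) := by
  have h1 : MeasurableSet {ω | history J l.length ω = l} := by
    rcases isEmpty_or_nonempty (Fin M) with hM | ⟨⟨j₀⟩⟩
    -- Without channels, the map `J 0` into an empty type forces `Ω` to be empty.
    · have := (Function.isEmpty (J 0) : IsEmpty Ω)
      exact Subsingleton.measurableSet
    · have : {ω | history J l.length ω = l} =
          ⋂ i, ⋂ (_ : i < l.length), J i ⁻¹' {l.getD i j₀} := by
        ext ω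
        simp [history_eq_iff j₀]
      rw [this]
      exact MeasurableSet.iInter fun i => MeasurableSet.iInter fun _ =>
        h.measurable_channel i (measurableSet_singleton _)
  exact h1.inter (measurableSet_le (Finset.measurable_sum _ fun i _ => h.measurable_wait i)
    measurable_const)

lemma IsChemicalChain.measurableSet_exactly (h : IsChemicalChain ν a x μ W J)
    (l : List (Fin M)) (t : ℝ) : MeasurableSet (exactly W J l t) :=
  (h.measurableSet_occurred l t).inter
    (measurableSet_lt measurable_const (Finset.measurable_sum _ fun i _ => h.measurable_wait i))

lemma IsChemicalChain.measure_occurred (ha : ∀ j x, 0 ≤ a j x) (h : IsChemicalChain ν a x μ W J)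
    (l : List (Fin M)) {t : ℝ} (ht : 0 ≤ t) :
    μ (occurred W J l t) = historyLaw ν a arrived l x t := by
  have := h.prob
  obtain ⟨ω₀⟩ := nonempty_of_isProbabilityMeasure μ
  have hmeas : Measurable fun ω (i : Fin l.length) => (W i ω).toReal :=
    measurable_pi_lambda _ fun i => (h.measurable_wait i).ennreal_toReal
  have hs : MeasurableSet {y : Fin l.length → ℝ | ∑ i, y i ≤ t} :=
    measurableSet_le (by fun_prop) measurable_const
  rw [← pi_stepMeasure_sum_le (J 0 ω₀), h.pi_eq_map ha, Measure.map_apply hmeas hs,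
    Measure.restrict_apply (hmeas hs)]
  congr 1
  ext ω
  simp only [occurred, mem_ofPred_eq, history_eq_iff (J 0 ω₀), mem_inter_iff, mem_preimage]
  have hsum : (∀ i < l.length, W i ω < ∞) → (∑ i : Fin l.length, (W i ω).toReal ≤ t ↔
      ∑ i ∈ Finset.range l.length, W i ω ≤ ENNReal.ofReal t) := by
    intro hW
    have hfin : ∑ i ∈ Finset.range l.length, W i ω ≠ ∞ :=
      ENNReal.sum_ne_top.2 fun i hi => (hW i (Finset.mem_range.1 hi)).ne
    rw [ENNReal.le_ofReal_iff_toReal_le hfin ht,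
      ENNReal.toReal_sum fun i hi => (hW i (Finset.mem_range.1 hi)).ne, Finset.sum_range]
  constructor
  · rintro ⟨h1, h2⟩
    have hW : ∀ i < l.length, W i ω < ∞ := fun i hi =>
      ((Finset.single_le_sum (f := fun i => W i ω) (fun _ _ => zero_le)
        (Finset.mem_range.2 hi)).trans h2).trans_lt ENNReal.ofReal_lt_top
    exact ⟨(hsum hW).2 h2, fun i hi => ⟨h1 i hi, hW i hi⟩⟩
  · rintro ⟨h1, h2⟩
    exact ⟨fun i hi => (h2 i hi).1, (hsum fun i hi => (h2 i hi).2).1 h1⟩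

/-- The event `occurred l` splits disjointly into `exactly l` and the events `occurred (l ++ [j])`.
The history laws satisfy the same identity, and the finite sum over `j` cancels. -/
lemma IsChemicalChain.measure_exactly (ha : ∀ j x, 0 ≤ a j x) (h : IsChemicalChain ν a x μ W J)
    (l : List (Fin M)) {t : ℝ} (ht : 0 ≤ t) :
    μ (exactly W J l t) = historyLaw ν a (waiting a) l x t := by
  have := h.prob
  have hset : occurred W J l t = exactly W J l t ∪ ⋃ j, occurred W J (l ++ [j]) t := by
    ext ω
    simp only [exactly, occurred, mem_ofPred_eq, mem_union, mem_iUnion, List.length_append,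
      List.length_singleton, history_succ]
    constructor
    · rintro ⟨h1, h2⟩
      rcases lt_or_ge (ENNReal.ofReal t) (∑ i ∈ Finset.range (l.length + 1), W i ω) with h3 | h3
      · exact Or.inl ⟨⟨h1, h2⟩, h3⟩
      · exact Or.inr ⟨_, by rw [h1], h3⟩
    · rintro (h1 | ⟨j, h1, h2⟩)
      · exact h1.1
      · exact ⟨(List.append_inj h1 (by simp)).1,
          (Finset.sum_le_sum_of_subset (Finset.range_mono (Nat.le_succ _))).trans h2⟩
  have hdisj : Pairwise (Function.onFun Disjoint fun j => occurred W J (l ++ [j]) t) := by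
    intro i j hij
    refine Set.disjoint_left.2 fun ω h1 h2 => hij ?_
    have h3 := h1.1.symm.trans (by simpa using h2.1)
    simpa using h3
  have hdisj' : Disjoint (exactly W J l t) (⋃ j, occurred W J (l ++ [j]) t) := by
    refine Set.disjoint_left.2 fun ω h1 h2 => ?_
    obtain ⟨j, hj⟩ := mem_iUnion.1 h2
    have h3 := hj.2
    rw [List.length_append, List.length_singleton] at h3
    exact absurd h1.2 (not_lt.2 h3)
  have hm := fun j => h.measurableSet_occurred (l ++ [j]) t
  have h1 : μ (occurred W J l t) =
      μ (exactly W J l t) + ∑ j, μ (occurred W J (l ++ [j]) t) := by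
    conv_lhs => rw [hset]
    rw [measure_union hdisj' (MeasurableSet.iUnion hm), measure_iUnion hdisj hm, tsum_fintype]
  have h2 := historyLaw_arrived_eq (ν := ν) ha l x t
  rw [← h.measure_occurred ha l ht, h1] at h2
  simp only [← h.measure_occurred ha _ ht] at h2
  refine (ENNReal.add_left_inj ?_).1 h2
  exact ENNReal.sum_ne_top.2 fun j _ => measure_ne_top _ _

/-- By non-explosion almost every path has some finite history up to time `t`, so the event is a.e.
a countable disjoint union of history events. -/
lemma IsChemicalChain.measure_transition (ha : ∀ j x, 0 ≤ a j x)
    (h : IsChemicalChain ν a x μ W J) (hne : NonExplosive μ W) (x' : State N) {t : ℝ}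
    (ht : 0 ≤ t) :
    μ {ω | shift ν x (reactionCount W J t ω) = x'} = historySum ν a x' x t := by
  classical
  have hae : {ω | shift ν x (reactionCount W J t ω) = x'} =ᵐ[μ]
      ⋃ l, if endState ν x l = x' then exactly W J l t else ∅ := by
    filter_upwards [hne] with ω hω
    obtain ⟨l, hl⟩ := exists_mem_exactly (J := J) (hω t)
    refine propext ⟨fun h1 => mem_iUnion.2 ⟨l, ?_⟩, fun h1 => ?_⟩
    · rw [if_pos]
      · exact hl
      · rw [← reactionCount_of_mem_exactly hl]; exact h1
    · obtain ⟨l', hl'⟩ := mem_iUnion.1 h1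
      split_ifs at hl' with h2
      · exact (reactionCount_of_mem_exactly hl').trans h2
      · exact absurd hl' (notMem_empty _)
  rw [measure_congr hae, measure_iUnion]
  · refine tsum_congr fun l => ?_
    split_ifs
    · exact h.measure_exactly ha l ht
    · exact measure_empty
  · intro l l' hll
    refine (exactly_disjoint (W := W) (J := J) t hll).mono ?_ ?_ <;> (dsimp only; split_ifs <;> simp)
  · intro l
    split_ifs
    exacts [h.measurableSet_exactly l t, MeasurableSet.empty]

end Chain

/-! ### Smoothness of the transition probabilities -/

section Transition

variable {N M : ℕ} {ν : Fin M → State N} {a : Fin M → State N → ℝ}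

lemma generator_hasDerivWithinAt {V V' : State N → ℝ → ℝ} {s : Set ℝ} {t : ℝ}
    (hV : ∀ y, HasDerivWithinAt (V y) (V' y t) s t) (x : State N) :
    HasDerivWithinAt (fun r => generator ν a (fun y => V y r) x)
      (generator ν a (fun y => V' y t) x) s t :=
  (HasDerivWithinAt.fun_sum fun j _ => (hV (x + ν j)).const_mul (a j x)).sub
    ((hV x).const_mul (totalPropensity a x))

/-- Solutions of the backward equation are smooth, with derivatives given by the powers of the
generator. -/
lemma contDiffOn_of_backward {V : State N → ℝ → ℝ}
    (hV : ∀ y, ∀ t ∈ Ici (0 : ℝ),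
      HasDerivWithinAt (V y) (generator ν a (fun z => V z t) y) (Ici 0) t) (x : State N) :
    ContDiffOn ℝ (⊤ : ℕ∞) (V x) (Ici 0) := by
  have hs : UniqueDiffOn ℝ (Ici (0 : ℝ)) := uniqueDiffOn_Ici 0
  refine contDiffOn_infty.2 fun n => ?_
  induction n generalizing x with
  | zero => exact contDiffOn_zero.2 fun t ht => (hV x t ht).continuousWithinAt
  | succ n ih =>
    refine (contDiffOn_succ_iff_derivWithin hs).2
      ⟨fun t ht => (hV x t ht).differentiableWithinAt,
        fun h => absurd h (WithTop.natCast_ne_top n), ?_⟩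
    have : ContDiffOn ℝ n (fun t => generator ν a (fun z => V z t) x) (Ici 0) :=
      (ContDiffOn.sum fun j _ => contDiffOn_const.mul (ih (x + ν j))).sub
        (contDiffOn_const.mul (ih x))
    exact this.congr fun t ht => (hV x t ht).derivWithin (hs t ht)

/-- If `V` solves the backward equation, so does its image under the generator, a finite linear
combination of its components; hence the induction runs over all `V`. -/
lemma iteratedDerivWithin_of_backward {V : State N → ℝ → ℝ}
    (hV : ∀ y, ∀ t ∈ Ici (0 : ℝ),
      HasDerivWithinAt (V y) (generator ν a (fun z => V z t) y) (Ici 0) t) (x : State N) (i : ℕ)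
    {t : ℝ} (ht : t ∈ Ici (0 : ℝ)) :
    iteratedDerivWithin i (V x) (Ici 0) t = (generator ν a)^[i] (fun y => V y t) x := by
  induction i generalizing V x with
  | zero => simp
  | succ i ih =>
    have hd : EqOn (derivWithin (V x) (Ici 0)) (fun t => generator ν a (fun z => V z t) x)
        (Ici 0) := fun t ht => (hV x t ht).derivWithin (uniqueDiffOn_Ici 0 t ht)
    have h1 := ih (V := fun y t => generator ν a (fun z => V z t) y)
      (fun y t ht => generator_hasDerivWithinAt (V := V)
        (V' := fun y t => generator ν a (fun z => V z t) y) (fun z => hV z t ht) y) x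
    rw [iteratedDerivWithin_succ', iteratedDerivWithin_congr hd ht, Function.iterate_succ_apply]
    exact h1

/-- Bounded solutions of the integrated backward equation solve the backward equation. -/
lemma hasDerivWithinAt_of_integral_eq {v : State N → ℝ → ℝ} {c : State N → ℝ}
    (hm : ∀ y, Measurable (v y)) (hb : ∀ y t, |v y t| ≤ 1)
    (hv : ∀ y, ∀ t ∈ Ici (0 : ℝ), v y t = c y * Real.exp (-(totalPropensity a y) * t) +
      ∑ j, ∫ s in 0..t, a j y * Real.exp (-(totalPropensity a y) * s) * v (y + ν j) (t - s))
    (x : State N) {t : ℝ} (ht : t ∈ Ici (0 : ℝ)) :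
    HasDerivWithinAt (v x) (generator ν a (fun z => v z t) x) (Ici 0) t := by
  -- Freezing `v` at its value at `0` for negative times makes two-sided calculus available at the
  -- end point `t = 0`.
  set w : State N → ℝ → ℝ := fun y r => v y (max r 0) with hw
  have hint : ∀ y b d, IntervalIntegrable (w y) volume b d := fun y b d => by
    rw [intervalIntegrable_iff]
    exact Measure.integrableOn_of_bounded (M := 1) (by simp)
      ((hm y).comp (measurable_id.max measurable_const)).aestronglyMeasurable
      (Filter.Eventually.of_forall fun r => hb _ _)
  have hint' : ∀ y z b d, IntervalIntegrable
      (fun r => Real.exp (totalPropensity a y * r) * w z r) volume b d := fun y z b d =>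
    (hint z b d).continuousOn_mul (by fun_prop)
  -- Substituting `r = t - s` factors out `exp(-a₀ t)`, leaving `t` only in the upper limit of the
  -- integral.
  have hformula : ∀ y, ∀ t ∈ Ici (0 : ℝ), v y t = Real.exp (-(totalPropensity a y) * t) *
      (c y + ∑ j, a j y * ∫ r in 0..t, Real.exp (totalPropensity a y * r) * w (y + ν j) r) := by
    intro y t ht
    rw [hv y t ht, mul_add, Finset.mul_sum, mul_comm (c y)]
    congr 1
    refine Finset.sum_congr rfl fun j _ => ?_
    have h1 := intervalIntegral.integral_comp_sub_left (a := 0) (b := t) (fun r => a j y *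
      Real.exp (-(totalPropensity a y) * (t - r)) * v (y + ν j) r) t
    simp only [sub_sub_cancel, sub_self, sub_zero] at h1
    rw [h1, ← intervalIntegral.integral_const_mul, ← intervalIntegral.integral_const_mul]
    refine intervalIntegral.integral_congr fun r hr => ?_
    rw [uIcc_of_le ht] at hr
    have h2 : w (y + ν j) r = v (y + ν j) r := by simp [hw, hr.1]
    have h3 : Real.exp (-(totalPropensity a y) * (t - r)) =
        Real.exp (-(totalPropensity a y) * t) * Real.exp (totalPropensity a y * r) := by
      rw [← Real.exp_add]
      ring_nf
    simp only [h2, h3]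
    ring
  -- Bootstrap: boundedness makes the primitives continuous, hence `v`; continuity of `v` then makes
  -- the primitives differentiable.
  have hcont : ∀ y, ContinuousOn (v y) (Ici 0) := by
    intro y
    refine ContinuousOn.congr (Continuous.continuousOn ?_) (hformula y)
    refine (by fun_prop : Continuous fun t => Real.exp (-(totalPropensity a y) * t)).mul
      (continuous_const.add (continuous_finsetSum _ fun j _ => continuous_const.mul ?_))
    exact intervalIntegral.continuous_primitive (fun b d => hint' _ _ b d) 0
  have hwc : ∀ y, Continuous (w y) := fun y =>
    (hcont y).comp_continuous (by fun_prop) fun r =>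
    mem_Ici.2 (le_max_right r 0)
  have hwt : ∀ y, w y t = v y t := fun y => by simp [hw, mem_Ici.1 ht]
  have hd1 : HasDerivAt (fun t => Real.exp (-(totalPropensity a x) * t))
      (-(totalPropensity a x) * Real.exp (-(totalPropensity a x) * t)) t := by
    have := ((hasDerivAt_id t).const_mul (-(totalPropensity a x))).exp
    convert! this using 1
    simp only [id]
    ring
  have hd2 : HasDerivAt (fun t => c x + ∑ j, a j x *
      ∫ r in 0..t, Real.exp (totalPropensity a x * r) * w (x + ν j) r)
      (∑ j, a j x * (Real.exp (totalPropensity a x * t) * w (x + ν j) t)) t := by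
    refine (HasDerivAt.fun_sum fun j _ => HasDerivAt.const_mul (a j x) ?_).const_add (c x)
    have hcont' : Continuous fun r => Real.exp (totalPropensity a x * r) * w (x + ν j) r :=
      (by fun_prop : Continuous fun r => Real.exp (totalPropensity a x * r)).mul (hwc _)
    exact intervalIntegral.integral_hasDerivAt_right (hcont'.intervalIntegrable _ _)
      (hcont'.stronglyMeasurableAtFilter _ _) hcont'.continuousAt
  have hd := ((hd1.mul hd2).hasDerivWithinAt (s := Ici 0)).congr (hformula x) (hformula x t ht)
  convert! hd using 1
  rw [mul_assoc, ← hformula x t ht, generator, Finset.mul_sum]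
  have h4 : Real.exp (-(totalPropensity a x) * t) * Real.exp (totalPropensity a x * t) = 1 := by
    rw [← Real.exp_add]
    simp
  have h5 : ∀ j, Real.exp (-(totalPropensity a x) * t) *
      (a j x * (Real.exp (totalPropensity a x * t) * w (x + ν j) t)) = a j x * v (x + ν j) t := by
    intro j
    rw [hwt, mul_left_comm, ← mul_assoc (Real.exp _) (Real.exp _), h4, one_mul]
  simp only [h5]
  ring

variable {Ω : Type*} [MeasurableSpace Ω] {μ : State N → Measure Ω} {W : ℕ → Ω → ℝ≥0∞}
  {J : ℕ → Ω → Fin M}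

/-- For `t ≥ 0` the sum is a probability; this supplies the bound on which the regularity argument
rests. -/
lemma historySum_le_one (ha : ∀ j x, 0 ≤ a j x) (hX : ∀ x, IsChemicalChain ν a x (μ x) W J)
    (hne : ∀ x, NonExplosive (μ x) W) (x' y : State N) (t : ℝ) : historySum ν a x' y t ≤ 1 := by
  rcases lt_or_ge t 0 with ht | ht
  · rw [historySum_of_neg x' y ht]
    exact zero_le
  · have := (hX y).prob
    rw [← (hX y).measure_transition ha (hne y) x' ht]
    exact prob_le_one

lemma transition_eq_historySum (ha : ∀ j x, 0 ≤ a j x)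
    (hX : ∀ x, IsChemicalChain ν a x (μ x) W J) (hne : ∀ x, NonExplosive (μ x) W)
    (x' y : State N) {t : ℝ} (ht : 0 ≤ t) :
    transition ν μ W J t y x' = (historySum ν a x' y t).toReal := by
  rw [transition, measureReal_def, (hX y).measure_transition ha (hne y) x' ht]

lemma historySum_integral_eq (ha : ∀ j x, 0 ≤ a j x) {x' : State N}
    (h1 : ∀ y t, historySum ν a x' y t ≤ 1) (y : State N) {t : ℝ} (ht : 0 ≤ t) :
    (historySum ν a x' y t).toReal =
      (if y = x' then 1 else 0) * Real.exp (-(totalPropensity a y) * t) +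
      ∑ j, ∫ s in 0..t, a j y * Real.exp (-(totalPropensity a y) * s) *
        (historySum ν a x' (y + ν j) (t - s)).toReal := by
  have hnn : ∀ j, 0 ≤ ∫ s in 0..t, a j y * Real.exp (-(totalPropensity a y) * s) *
      (historySum ν a x' (y + ν j) (t - s)).toReal := fun j =>
    intervalIntegral.integral_nonneg ht fun s _ =>
      mul_nonneg (mul_nonneg (ha j y) (Real.exp_nonneg _)) ENNReal.toReal_nonneg
  have h0 : 0 ≤ (if y = x' then (1 : ℝ) else 0) * Real.exp (-(totalPropensity a y) * t) := by
    split_ifs <;> simp [Real.exp_nonneg]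
  have h2 : ∀ j, ∫⁻ s, historySum ν a x' (y + ν j) (t - s) ∂stepMeasure a y j =
      ENNReal.ofReal (∫ s in 0..t, a j y * Real.exp (-(totalPropensity a y) * s) *
        (historySum ν a x' (y + ν j) (t - s)).toReal) := fun j =>
    lintegral_stepMeasure_sub ha y j (measurable_historySum _ _)
      (fun t ht => historySum_of_neg _ _ ht) (h1 _) ht
  have h3 : (if y = x' then waiting a y t else 0) = ENNReal.ofReal
      ((if y = x' then (1 : ℝ) else 0) * Real.exp (-(totalPropensity a y) * t)) := by
    split_ifs <;> simp [waiting, ht]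
  conv_lhs => rw [historySum_eq]
  simp only [h2, h3]
  rw [← ENNReal.ofReal_sum_of_nonneg fun j _ => hnn j, ← ENNReal.ofReal_add h0
    (Finset.sum_nonneg fun j _ => hnn j), ENNReal.toReal_ofReal
    (add_nonneg h0 (Finset.sum_nonneg fun j _ => hnn j))]

lemma transition_deriv (ha : ∀ j x, 0 ≤ a j x) (hX : ∀ x, IsChemicalChain ν a x (μ x) W J)
    (hne : ∀ x, NonExplosive (μ x) W) (x x' : State N) :
    ContDiffOn ℝ (⊤ : ℕ∞) (fun τ => transition ν μ W J τ x x') (Ici 0) ∧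
    ∀ i, iteratedDerivWithin i (fun τ => transition ν μ W J τ x x') (Ici 0) 0 =
      (generator ν a)^[i] (fun y => if y = x' then 1 else 0) x := by
  have h1 := historySum_le_one ha hX hne x'
  set v : State N → ℝ → ℝ := fun y t => (historySum ν a x' y t).toReal
  have hv : ∀ y, ∀ t ∈ Ici (0 : ℝ), v y t =
      (if y = x' then 1 else 0) * Real.exp (-(totalPropensity a y) * t) +
      ∑ j, ∫ s in 0..t, a j y * Real.exp (-(totalPropensity a y) * s) * v (y + ν j) (t - s) :=
    fun y t ht => historySum_integral_eq ha h1 y ht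
  have hd := fun y t ht => hasDerivWithinAt_of_integral_eq (a := a) (ν := ν) (v := v)
    (fun y => (measurable_historySum x' y).ennreal_toReal)
    (fun y t => by
      rw [abs_of_nonneg ENNReal.toReal_nonneg]
      exact ENNReal.toReal_le_of_le_ofReal zero_le_one (by simpa using h1 y t)) hv y (t := t) ht
  have heq : EqOn (fun τ => transition ν μ W J τ x x') (v x) (Ici 0) := fun t ht =>
    transition_eq_historySum ha hX hne x' x ht
  refine ⟨(contDiffOn_of_backward hd x).congr heq, fun i => ?_⟩
  rw [iteratedDerivWithin_congr heq self_mem_Ici,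
    iteratedDerivWithin_of_backward hd x i self_mem_Ici]
  refine congrFun (congrArg _ (funext fun y => ?_)) x
  -- At time `0` the integrals vanish and only the indicator of `x'` remains.
  rw [hv y 0 self_mem_Ici]
  simp

end Transition

end TauLeap

theorem mainTheorem9 {N M : ℕ}
    (ν : Fin M → TauLeap.State N) (a : Fin M → TauLeap.State N → ℝ)
    (ha : ∀ j x, 0 ≤ a j x)
    -- the exact chain, started at each state
    {Ω : Type*} [MeasurableSpace Ω] (μ : TauLeap.State N → Measure Ω)
    (W : ℕ → Ω → ℝ≥0∞) (J : ℕ → Ω → Fin M)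
    (hX : ∀ x, TauLeap.IsChemicalChain ν a x (μ x) W J)
    (hne : ∀ x, TauLeap.NonExplosive (μ x) W)
    (hgrowth : TauLeap.PolynomialGrowth a)
    -- the tau leap method
    (q : ℕ) (δ : ℝ) (hδ : 0 < δ) (S : Set (TauLeap.State N))
    (κ : ℝ → TauLeap.State N → Measure (TauLeap.Counts M))
    (hκ : TauLeap.IsPoissonBinomialMethod q δ S κ)
    (hcons : TauLeap.CountConsistent q δ S ν a κ) :
    TauLeap.PointwiseConsistent q δ S (TauLeap.leapProb ν κ) (TauLeap.transition ν μ W J) := by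
  intro x hx x'
  obtain ⟨hleap, hleap'⟩ := hκ.leapProb_deriv hδ ν hx x'
  obtain ⟨htrans, htrans'⟩ := TauLeap.transition_deriv ha hX hne x x'
  refine ⟨hleap, htrans, fun i hi hiq => ?_⟩
  -- Once the generator power is rewritten as a sum over the fibre of `x'`, consistency of the
  -- counts matches the two sums term by term.
  rw [hleap' i (by omega), htrans' i, ← TauLeap.tsum_indicator_matPow]
  congr! 3 with k
  exact funext fun k => hcons x hx k i hi hiq
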